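/- Let $q$ be a prime number, let $K' = \mathbb{Q}(\sqrt{-2q})$, and let $h_{K'}$ denote the class number of $K'$ (the order of the ideal class group of its ring of integers). (i) If $q \equiv 7 \pmod{16}$, then $4$ exactly divides $h_{K'}$, i.e. $4 \mid h_{K'}$ and $8 \nmid h_{K'}$. (ii) If $q \equiv 15 \pmod{16}$, then $8 \mid h_{K'}$. -/

import Mathlib

namespace Zsqrtd

/-! Put `d = -2q`; for odd `q` the ring of integers is `ℤ√d`. Ambiguous ideals show that the
2-torsion of the class group is `{1, t}`, where `t ≠ 1` is the class of the prime above 2. Hence the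
2-part is cyclic, and the question is how often `t` can be halved.

Since `q ≡ 7 mod 8`, one can write `q = u² - 2v²`. The element `β = 2v + √d` then has norm `2u²`,
and the ideal `(u, β)`, of norm `|u|`, has a class `x` with `x² = t` (`sq_mk0_mul_classAboveTwo`).
So `x` has order 4 and `4 ∣ h`.

Everything now turns on whether `x` is a square. A genus character gives an obstruction: an ideal of
odd norm whose class is a square has norm `≡ ±1 mod 8` (`emod_eight_of_isSquare_mk0`). As `v` is
odd, `u² ≡ q + 2 mod 16`. If `q ≡ 7 mod 16`, then `u ≡ ±3 mod 8`, so `x` is not a square and `8 ∤ h`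
(`not_eight_dvd_card`). If `q ≡ 15 mod 16`, then `u ≡ ±1 mod 8`, and comparison with one class known
to be a nonsquare shows that `x` is a square, so its square root has order 8. -/

/-! ### Ideals of `ℤ√d`: standard form, conjugation and norm. -/

theorem intCast_add_intCast_mul_mem {d : ℤ} {M : Ideal (ℤ√d)} {z w : ℤ√d} (m n : ℤ)
    (hz : z ∈ M) (hw : w ∈ M) : (m : ℤ√d) * z + n * w ∈ M :=
  M.add_mem (M.mul_mem_left _ hz) (M.mul_mem_left _ hw)

theorem sqrtd_mul_mem {d : ℤ} {M : Ideal (ℤ√d)} {z : ℤ√d} (hz : z ∈ M) :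
    (⟨d * z.im, z.re⟩ : ℤ√d) ∈ M := by
  have := M.mul_mem_left (sqrtd (d := d)) hz
  rwa [show z = ⟨z.re, z.im⟩ from rfl, muld_val] at this

/-- The `√d`-coordinates of `M` form an ideal `(c)` of `ℤ`. Multiplication by `√d` moves the real
part into that coordinate, so `c` divides real parts too and factors out. The integer `a` comes from
`M ∩ ℤ = (ca)`. -/
theorem exists_eq_span_mul_span {d : ℤ} (hd : d < 0) {M : Ideal (ℤ√d)} (hM : M ≠ ⊥) :
    ∃ c a b : ℤ, c ≠ 0 ∧ 0 < a ∧ a ∣ b ^ 2 - d ∧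
      M = Ideal.span {(c : ℤ√d)} * Ideal.span {(a : ℤ√d), ⟨b, 1⟩} := by
  obtain ⟨z, hzM, hz0⟩ := Submodule.exists_mem_ne_zero_of_ne_bot hM
  have hN : ((z.norm : ℤ) : ℤ√d) ∈ M := by
    rw [norm_eq_mul_conj]; exact M.mul_mem_right _ hzM
  have hN0 : z.norm ≠ 0 := fun h => hz0 ((norm_eq_zero_iff hd z).1 h)
  let Y : Ideal ℤ :=
    { carrier := {y | ∃ x, (⟨x, y⟩ : ℤ√d) ∈ M}
      add_mem' := by
        rintro y y' ⟨x, h⟩ ⟨x', h'⟩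
        exact ⟨x + x', by simpa [add_def] using M.add_mem h h'⟩
      zero_mem' := ⟨0, M.zero_mem⟩
      smul_mem' := by
        rintro n y ⟨x, h⟩
        exact ⟨n * x, by simpa [smul_val] using M.mul_mem_left (n : ℤ√d) h⟩ }
  obtain ⟨c, hc⟩ := (IsPrincipalIdealRing.principal Y).principal
  have hYdvd : ∀ w ∈ M, c ∣ w.im := fun w hw => by
    have : w.im ∈ Y := ⟨w.re, hw⟩
    rw [hc] at this
    exact Ideal.mem_span_singleton.1 this
  have hre : ∀ w ∈ M, c ∣ w.re := fun w hw => hYdvd _ (sqrtd_mul_mem hw)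
  have hcY : c ∈ Y := by rw [hc]; exact Ideal.mem_span_singleton_self c
  obtain ⟨x₀, hx₀⟩ := hcY
  obtain ⟨b, rfl⟩ : c ∣ x₀ := hre _ hx₀
  have hc0 : c ≠ 0 := by
    rintro rfl
    have := hre _ hN
    simp only [re_intCast, zero_dvd_iff] at this
    exact hN0 this
  obtain ⟨e', he'⟩ :=
    (IsPrincipalIdealRing.principal (M.comap (Int.castRingHom (ℤ√d)))).principal
  -- The generator is given the sign of `c`, which makes `a = e / c` positive.
  obtain ⟨e, he, hce⟩ : ∃ e : ℤ, M.comap (Int.castRingHom (ℤ√d)) = Submodule.span ℤ {e} ∧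
      0 ≤ c * e := by
    rcases le_total 0 (c * e') with h | h
    · exact ⟨e', he', h⟩
    · exact ⟨-e', he'.trans (Ideal.span_singleton_neg e').symm, by linarith⟩
  have hmem : ∀ n : ℤ, (n : ℤ√d) ∈ M ↔ e ∣ n := fun n => by
    rw [← Ideal.mem_span_singleton]
    change _ ↔ n ∈ Submodule.span ℤ {e}
    rw [← he]; simp [Ideal.mem_comap]
  obtain ⟨a, rfl⟩ : c ∣ e := by
    have := hre _ ((hmem e).2 dvd_rfl)
    simpa using this
  have hfac : (⟨c * b, c⟩ : ℤ√d) = (c : ℤ√d) * ⟨b, 1⟩ := by rw [smul_val]; simp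
  have ha0 : a ≠ 0 := by
    rintro rfl
    have := (hmem _).1 hN
    simp only [mul_zero, zero_dvd_iff] at this
    exact hN0 this
  have hapos : 0 < a := by
    rw [← mul_assoc] at hce
    exact lt_of_le_of_ne (nonneg_of_mul_nonneg_right hce (mul_self_pos.2 hc0)) ha0.symm
  refine ⟨c, a, b, hc0, hapos, ?_, ?_⟩
  · have h1 : ((c * (b ^ 2 - d) : ℤ) : ℤ√d) ∈ M := by
      rw [pow_two]
      have h2 := M.mul_mem_right (⟨b, -1⟩ : ℤ√d) hx₀
      convert h2 using 1
      ext <;> simp; ring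
    exact Int.dvd_of_mul_dvd_mul_left hc0 ((hmem _).1 h1)
  · rw [Ideal.span_mul_span']
    apply _root_.le_antisymm
    · intro w hw
      obtain ⟨k, hk⟩ := hYdvd w hw
      have h1 : ((w.re - k * (c * b) : ℤ) : ℤ√d) ∈ M := by
        have h2 := M.sub_mem hw (M.mul_mem_left (k : ℤ√d) hx₀)
        convert h2 using 1
        ext <;> simp [hk, mul_comm]
      obtain ⟨m, hm⟩ := (hmem _).1 h1
      have : w = (m : ℤ√d) * (c * a) + (k : ℤ√d) * (c * ⟨b, 1⟩) := by
        ext <;> simp [hk] <;> linarith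
      rw [this]
      apply intCast_add_intCast_mul_mem <;> apply Ideal.subset_span <;> simp
    · rw [Ideal.span_le]
      rintro w hw
      simp only [Set.singleton_mul, Set.mem_image, Set.mem_insert_iff, Set.mem_singleton_iff] at hw
      obtain ⟨w, rfl | rfl, rfl⟩ := hw
      · have := (hmem (c * a)).2 dvd_rfl
        simpa using this
      · rw [hfac] at hx₀; exact hx₀

/-- Primitivity of the form `(a, 2b, c)`: a common prime factor would also divide `b`, so its square
would divide `d`. -/
theorem exists_bezout_of_dvd_sq_sub {d : ℤ} (hd : Squarefree d) (hd4 : d % 4 = 2) {a b c : ℤ}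
    (h : b ^ 2 - d = a * c) : ∃ r s t : ℤ, r * a + s * (2 * b) + t * c = 1 := by
  have hcop : IsCoprime (Int.gcd a (2 * b) : ℤ) c := by
    refine isCoprime_of_prime_dvd ?_ fun p hp hpg hpc => ?_
    · rintro ⟨-, rfl⟩
      have hbd : d = b * b := by linarith
      have hu := hd b (hbd ▸ dvd_rfl)
      rcases Int.isUnit_iff.1 hu with rfl | rfl <;> omega
    · have hpa : p ∣ a := hpg.trans (Int.gcd_dvd_left ..)
      have hpb : p ∣ 2 * b := hpg.trans (Int.gcd_dvd_right ..)
      have hpp : p * p ∣ b ^ 2 - d := h ▸ mul_dvd_mul hpa hpc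
      have key : p ∣ b → False := fun hb => by
        have h1 : p * p ∣ d := by
          have := dvd_sub (mul_dvd_mul hb hb) hpp
          rwa [show b * b - (b ^ 2 - d) = d by ring] at this
        exact hp.not_isUnit (hd p h1)
      rcases hp.dvd_or_dvd hpb with h2 | hb
      · have h2' : Associated p 2 := hp.associated_of_dvd Int.prime_two h2
        have h3 : (2 : ℤ) ∣ b := by
          have h4 : (2 : ℤ) ∣ b ^ 2 - d := h2'.symm.dvd.trans ((dvd_mul_right p p).trans hpp)
          have h5 : (2 : ℤ) ∣ d := by omega
          have h6 : (2 : ℤ) ∣ b ^ 2 := by omega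
          exact Int.prime_two.dvd_of_dvd_pow h6
        exact key (h2'.dvd.trans h3)
      · exact key hb
  obtain ⟨m, t, hmt⟩ := hcop
  rw [Int.gcd_eq_gcd_ab] at hmt
  exact ⟨m * Int.gcdA a (2 * b), m * Int.gcdB a (2 * b), t, by rw [← hmt]; ring⟩

/-- The product contains `a²`, `2ab` and `b² - d = ac`, that is, `a` times three coprime integers.
-/
theorem span_mul_span_conj {d : ℤ} (hd : Squarefree d) (hd4 : d % 4 = 2) {a b : ℤ}
    (h : a ∣ b ^ 2 - d) :
    Ideal.span {(a : ℤ√d), ⟨b, 1⟩} * Ideal.span {(a : ℤ√d), ⟨b, -1⟩} =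
      Ideal.span {(a : ℤ√d)} := by
  obtain ⟨c, hc⟩ := h
  obtain ⟨r, s, t, hrst⟩ := exists_bezout_of_dvd_sq_sub hd hd4 hc
  have hcc : (⟨b, 1⟩ : ℤ√d) * ⟨b, -1⟩ = a * c := by
    have : b * b - d = a * c := by rw [← hc]; ring
    ext <;> simp <;> linarith
  apply _root_.le_antisymm
  · rw [Ideal.span_mul_span', Ideal.span_le]
    rintro w hw
    obtain ⟨x, hx, y, hy, rfl⟩ := Set.mem_mul.1 hw
    simp only [Set.mem_insert_iff, Set.mem_singleton_iff] at hx hy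
    rw [SetLike.mem_coe, Ideal.mem_span_singleton]
    rcases hx with rfl | rfl
    · exact dvd_mul_right _ _
    · rcases hy with rfl | rfl
      · exact dvd_mul_left _ _
      · rw [hcc]; exact dvd_mul_right _ _
  · rw [Ideal.span_singleton_le_iff_mem]
    have e : (a : ℤ√d) = r * (a * a) + s * (a * ⟨b, -1⟩ + ⟨b, 1⟩ * a) + t * (⟨b, 1⟩ * ⟨b, -1⟩) := by
      rw [hcc]
      calc (a : ℤ√d) = a * ((r * a + s * (2 * b) + t * c : ℤ) : ℤ√d) := by rw [hrst]; simp
        _ = _ := by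
          ext <;> simp <;> ring
    have ha : ∀ n : ℤ, (a : ℤ√d) ∈ Ideal.span {(a : ℤ√d), ⟨b, n⟩} := fun n =>
      Ideal.subset_span (Set.mem_insert _ _)
    have hb : ∀ n : ℤ, (⟨b, n⟩ : ℤ√d) ∈ Ideal.span {(a : ℤ√d), ⟨b, n⟩} := fun n =>
      Ideal.subset_span (Set.mem_insert_of_mem _ rfl)
    have hmem := Ideal.add_mem _ (Ideal.add_mem _
      (Ideal.mul_mem_left _ (r : ℤ√d) (Ideal.mul_mem_mul (ha 1) (ha (-1))))
      (Ideal.mul_mem_left _ (s : ℤ√d) (Ideal.add_mem _ (Ideal.mul_mem_mul (ha 1) (hb (-1)))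
        (Ideal.mul_mem_mul (hb 1) (ha (-1))))))
      (Ideal.mul_mem_left _ (t : ℤ√d) (Ideal.mul_mem_mul (hb 1) (hb (-1))))
    rwa [← e] at hmem

theorem map_star_span_pair {d : ℤ} (a b : ℤ) :
    (Ideal.span {(a : ℤ√d), ⟨b, 1⟩}).map (starRingEnd (ℤ√d)) =
      Ideal.span {(a : ℤ√d), ⟨b, -1⟩} := by
  rw [Ideal.map_span, Set.image_pair]
  simp [starRingEnd_apply, star_mk]

theorem map_star_span_singleton {d : ℤ} (z : ℤ√d) :
    (Ideal.span {z}).map (starRingEnd (ℤ√d)) = Ideal.span {star z} := by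
  rw [Ideal.map_span, Set.image_singleton, starRingEnd_apply]

theorem map_star_map_star {d : ℤ} (M : Ideal (ℤ√d)) :
    (M.map (starRingEnd (ℤ√d))).map (starRingEnd (ℤ√d)) = M := by
  rw [Ideal.map_map, show (starRingEnd (ℤ√d)).comp (starRingEnd (ℤ√d)) = RingHom.id _ from
    RingHom.ext fun z => by simp, Ideal.map_id]

theorem exists_mul_map_star_eq {d : ℤ} (hd0 : d < 0) (hd : Squarefree d) (hd4 : d % 4 = 2)
    {M : Ideal (ℤ√d)} (hM : M ≠ ⊥) :
    ∃ n : ℤ, n ≠ 0 ∧ M * M.map (starRingEnd (ℤ√d)) = Ideal.span {(n : ℤ√d)} := by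
  obtain ⟨c, a, b, hc, ha, hab, rfl⟩ := exists_eq_span_mul_span hd0 hM
  refine ⟨c * c * a, by simp [hc, ha.ne'], ?_⟩
  rw [Ideal.map_mul, map_star_span_pair, map_star_span_singleton, mul_mul_mul_comm,
    span_mul_span_conj hd hd4 hab, Ideal.span_singleton_mul_span_singleton,
    Ideal.span_singleton_mul_span_singleton]
  simp


/-! ### Ambiguous ideals and the 2-torsion of the class group. -/

open scoped nonZeroDivisors

/-- When `M` is its own conjugate it contains `2b = (b + √d) + (b - √d)`. Then `2b(b - √d)` lies in
`M` times its conjugate, which is `(a)`; compare `√d`-coordinates. -/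
theorem dvd_two_mul_of_map_star_eq {d : ℤ} (hd : Squarefree d) (hd4 : d % 4 = 2) {a b : ℤ}
    (h : a ∣ b ^ 2 - d)
    (hM : (Ideal.span {(a : ℤ√d), ⟨b, 1⟩}).map (starRingEnd (ℤ√d)) =
      Ideal.span {(a : ℤ√d), ⟨b, 1⟩}) : a ∣ 2 * b := by
  rw [map_star_span_pair] at hM
  have h1 : (⟨b, 1⟩ : ℤ√d) ∈ Ideal.span {(a : ℤ√d), ⟨b, 1⟩} := Ideal.subset_span (by simp)
  have h2 : (⟨b, -1⟩ : ℤ√d) ∈ Ideal.span {(a : ℤ√d), ⟨b, -1⟩} := Ideal.subset_span (by simp)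
  have h3 : (⟨b, -1⟩ : ℤ√d) ∈ Ideal.span {(a : ℤ√d), ⟨b, 1⟩} := hM ▸ h2
  have h4 := Ideal.mul_mem_mul (Ideal.add_mem _ h1 h3) h2
  rw [span_mul_span_conj hd hd4 h, Ideal.mem_span_singleton, intCast_dvd] at h4
  have h5 := h4.2
  simp at h5
  rw [two_mul, ← Int.dvd_neg, neg_add]
  exact h5

theorem span_pair_eq_of_dvd {d a b : ℤ} (h : a ∣ b) :
    Ideal.span {(a : ℤ√d), ⟨b, 1⟩} = Ideal.span {(a : ℤ√d), sqrtd} := by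
  obtain ⟨k, rfl⟩ := h
  have : (⟨a * k, 1⟩ : ℤ√d) = sqrtd + (k : ℤ√d) * (a : ℤ√d) := by ext <;> simp [mul_comm]
  rw [this]
  refine (Ideal.span_pair_add_mul_left (x := (a : ℤ√d)) (y := sqrtd) (k : ℤ√d))

theorem exists_eq_or_of_dvd_sq_add {q : ℕ} (hq : q.Prime) (hq2 : q ≠ 2) {a b : ℤ} (ha : 0 < a)
    (h : a ∣ b ^ 2 + 2 * q) (h2 : a ∣ 2 * b) :
    a ∣ b ∧ (a = 1 ∨ a = 2 ∨ a = q ∨ a = 2 * q) := by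
  have hqo : (q : ℤ) % 2 = 1 := by have := hq.eq_two_or_odd; omega
  have key : ∀ {a : ℤ}, 0 < a → a % 2 = 1 → a ∣ b ^ 2 + 2 * q → a ∣ 2 * b →
      a ∣ b ∧ (a = 1 ∨ a = q) := by
    intro a ha0 ha h h2
    have hc : IsCoprime a 2 := ⟨1, -(a / 2), by omega⟩
    have hb : a ∣ b := hc.dvd_of_dvd_mul_left h2
    refine ⟨hb, ?_⟩
    have h3 : a ∣ 2 * q := (dvd_add_right (dvd_pow hb two_ne_zero)).1 h
    have h4 : a ∣ q := hc.dvd_of_dvd_mul_left h3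
    lift a to ℕ using ha0.le
    rcases (Nat.dvd_prime hq).1 (Int.natCast_dvd_natCast.1 h4) with rfl | rfl <;> simp
  rcases Int.emod_two_eq_zero_or_one a with ha2 | ha2
  · obtain ⟨c, rfl⟩ := Int.dvd_of_emod_eq_zero ha2
    have hb2 : (2 : ℤ) ∣ b := by
      have h1 : (2 : ℤ) ∣ b ^ 2 := (Int.dvd_add_left (Int.dvd_mul_right 2 q)).1
        ((Int.dvd_mul_right 2 c).trans h)
      exact Int.prime_two.dvd_of_dvd_pow h1
    have hc2 : c % 2 = 1 := by
      by_contra hne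
      obtain ⟨e, rfl⟩ : (2 : ℤ) ∣ c := by omega
      obtain ⟨f, rfl⟩ := hb2
      obtain ⟨g, hg⟩ := h
      have : 4 * (f ^ 2) + 2 * (q : ℤ) = 4 * (e * g) := by linarith
      omega
    obtain ⟨h1, h3⟩ := key (by linarith) hc2 ((Int.dvd_mul_left 2 c).trans h)
      ((Int.dvd_mul_left 2 c).trans h2)
    have hcop : IsCoprime (2 : ℤ) c := ⟨-(c / 2), 1, by omega⟩
    refine ⟨hcop.mul_dvd hb2 h1, ?_⟩
    rcases h3 with rfl | rfl <;> simp
  · obtain ⟨h1, h3⟩ := key ha ha2 h h2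
    exact ⟨h1, by tauto⟩

theorem squarefree_neg_two_mul {q : ℕ} (hq : q.Prime) (hq2 : q ≠ 2) :
    Squarefree (-(2 * (q : ℤ))) := by
  rw [← Int.squarefree_natAbs, Int.natAbs_neg, Int.natAbs_mul, Int.natAbs_natCast]
  exact (Nat.squarefree_mul ((Nat.coprime_primes Nat.prime_two hq).2 hq2.symm)).2
    ⟨Nat.prime_two.prime.squarefree, hq.prime.squarefree⟩

theorem neg_two_mul_emod_four {q : ℕ} (hq : q.Prime) (hq2 : q ≠ 2) :
    (-(2 * (q : ℤ))) % 4 = 2 := by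
  have := hq.eq_two_or_odd
  omega

theorem sqrtd_ne_zero {d : ℤ} : (sqrtd : ℤ√d) ≠ 0 := fun h => by
  simpa using congrArg Zsqrtd.im h

theorem span_two_sqrtd_mem_nonZeroDivisors {d : ℤ} [IsDomain (ℤ√d)] :
    Ideal.span {(2 : ℤ√d), sqrtd} ∈ (Ideal (ℤ√d))⁰ := by
  rw [mem_nonZeroDivisors_iff_ne_zero]
  intro h
  have : (2 : ℤ√d) ∈ (0 : Ideal (ℤ√d)) := h ▸ Ideal.subset_span (by simp)
  simp at this

/-- The class of the prime ideal above `2`. -/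
noncomputable def classAboveTwo (d : ℤ) [IsDedekindDomain (ℤ√d)] : ClassGroup (ℤ√d) :=
  ClassGroup.mk0 ⟨Ideal.span {(2 : ℤ√d), sqrtd}, span_two_sqrtd_mem_nonZeroDivisors⟩

/-- Hilbert 90 for the norm-one element `x / y`: the usual choice is `z = x + star y`, and the case
where this vanishes is treated separately. -/
theorem exists_span_mul_eq_span_star_mul {d : ℤ} [IsDedekindDomain (ℤ√d)]
    {I J : Ideal (ℤ√d)} {x y : ℤ√d} (hy : y ≠ 0)
    (h : Ideal.span {x} * I = Ideal.span {y} * J) (hxy : x * star x = y * star y) :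
    ∃ z : ℤ√d, z ≠ 0 ∧ Ideal.span {z} * I = Ideal.span {star z} * J := by
  by_cases h0 : x + star y = 0
  · refine ⟨star y * sqrtd, ?_, ?_⟩
    · refine mul_ne_zero (star_ne_zero.2 hy) fun h => ?_
      simpa using congrArg Zsqrtd.im h
    · have hx : x = - star y := eq_neg_of_add_eq_zero_left h0
      have hs : star (sqrtd : ℤ√d) = - sqrtd := by ext <;> simp
      rw [hx, Ideal.span_singleton_neg] at h
      rw [mul_comm, star_mul, star_star, hs, neg_mul, Ideal.span_singleton_neg,
        mul_comm I, mul_comm (star y), ← Ideal.span_singleton_mul_span_singleton,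
        ← Ideal.span_singleton_mul_span_singleton, mul_assoc, mul_assoc, h]
  · refine ⟨x + star y, h0, ?_⟩
    have hy' : Ideal.span {y} ≠ (0 : Ideal (ℤ√d)) := by simpa using hy
    apply mul_left_cancel₀ hy'
    have e : y * (x + star y) = star (x + star y) * x := by
      rw [star_add, star_star, add_mul, mul_add, ← hxy]; ring
    rw [← mul_assoc, Ideal.span_singleton_mul_span_singleton, e,
      ← Ideal.span_singleton_mul_span_singleton, mul_assoc, h]
    ring

theorem mk0_eq_one_or_of_map_star_eq {q : ℕ} (hq : q.Prime) (hq2 : q ≠ 2)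
    {d : ℤ} (hd : d = -(2 * q)) [IsDedekindDomain (ℤ√d)] (M : (Ideal (ℤ√d))⁰)
    (hM : M.1.map (starRingEnd _) = M.1) :
    ClassGroup.mk0 M = 1 ∨ ClassGroup.mk0 M = classAboveTwo _ := by
  have hq0 := hq.pos
  have hM0 : M.1 ≠ ⊥ := nonZeroDivisors.coe_ne_zero M
  obtain ⟨c, a, b, hc, ha, hab, hMeq⟩ := exists_eq_span_mul_span (by omega) hM0
  have hc' : (c : ℤ√d) ≠ 0 := by simpa using hc
  have hstar : (Ideal.span {(a : ℤ√d), ⟨b, 1⟩}).map (starRingEnd _) =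
      Ideal.span {(a : ℤ√d), ⟨b, 1⟩} := by
    rw [hMeq, Ideal.map_mul, map_star_span_singleton, star_intCast] at hM
    refine mul_left_cancel₀ ?_ hM
    simpa using hc
  have h2b := dvd_two_mul_of_map_star_eq (hd ▸ squarefree_neg_two_mul hq hq2)
    (hd ▸ neg_two_mul_emod_four hq hq2) hab hstar
  rw [hd, sub_neg_eq_add] at hab
  obtain ⟨hb, ha'⟩ := exists_eq_or_of_dvd_sq_add hq hq2 ha hab h2b
  rw [span_pair_eq_of_dvd hb] at hMeq
  have hs : (sqrtd : ℤ√d) * sqrtd = -(2 * (q : ℤ√d)) := by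
    rw [dmuld, hd]; simp
  rcases ha' with rfl | rfl | rfl | rfl
  · left
    rw [ClassGroup.mk0_eq_one_iff]
    refine ⟨c, ?_⟩
    rw [hMeq, Int.cast_one, (Ideal.eq_top_iff_one (Ideal.span {1, _})).2
      (Ideal.subset_span (by simp)), Ideal.mul_top]
  · right
    rw [classAboveTwo, ClassGroup.mk0_eq_mk0_iff]
    refine ⟨1, c, one_ne_zero, hc', ?_⟩
    simp [hMeq]
  · right
    rw [classAboveTwo, ClassGroup.mk0_eq_mk0_iff]
    -- Because `√d² = -2q`, one has `2 · (q, √d) = √d · (2, √d)`.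
    refine ⟨2, (c : ℤ√d) * sqrtd, two_ne_zero, mul_ne_zero hc' sqrtd_ne_zero, ?_⟩
    simp only [hMeq]
    rw [← Ideal.span_singleton_mul_span_singleton, mul_left_comm, mul_assoc]
    congr 1
    rw [Ideal.span_mul_span', Ideal.span_mul_span', Set.singleton_mul, Set.singleton_mul,
      Set.image_pair, Set.image_pair, hs, Ideal.span_pair_neg, Ideal.span_pair_comm]
    simp [mul_comm]
  · left
    rw [ClassGroup.mk0_eq_one_iff]
    refine ⟨(c : ℤ√d) * sqrtd, ?_⟩
    have h1 : Ideal.span {((2 * q : ℤ) : ℤ√d), sqrtd} = Ideal.span {sqrtd} := by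
      rw [Ideal.span_pair_comm]
      refine Ideal.span_pair_eq_span_left_iff_dvd.2 ⟨-sqrtd, ?_⟩
      rw [mul_neg, hs]; simp
    rw [hMeq, h1, Ideal.span_singleton_mul_span_singleton]

/-- A class killed by 2 is fixed by conjugation. Hilbert 90 turns this into a representative ideal
that is itself fixed, and those are classified. -/
theorem eq_one_or_eq_classAboveTwo_of_sq_eq_one {q : ℕ} (hq : q.Prime) (hq2 : q ≠ 2)
    {d : ℤ} (hd : d = -(2 * q)) [IsDedekindDomain (ℤ√d)] {c : ClassGroup (ℤ√d)}
    (hc : c ^ 2 = 1) : c = 1 ∨ c = classAboveTwo _ := by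
  have hq0 := hq.pos
  obtain ⟨I, rfl⟩ := ClassGroup.mk0_surjective c
  have hI0 : I.1 ≠ ⊥ := nonZeroDivisors.coe_ne_zero I
  have hd0 : d < 0 := by omega
  obtain ⟨n, hn, hmul⟩ := exists_mul_map_star_eq hd0 (hd ▸ squarefree_neg_two_mul hq hq2)
    (hd ▸ neg_two_mul_emod_four hq hq2) hI0
  have hJ0 : I.1.map (starRingEnd _) ≠ 0 := by
    intro h
    rw [h, mul_zero] at hmul
    have := hmul.symm
    simp [hn] at this
  have hJ := mem_nonZeroDivisors_iff_ne_zero.2 hJ0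
  have h1 : ClassGroup.mk0 I = ClassGroup.mk0 ⟨_, hJ⟩ := by
    have h2 : ClassGroup.mk0 I = (ClassGroup.mk0 ⟨_, hJ⟩)⁻¹ :=
      ClassGroup.mk0_eq_mk0_inv_iff.2 ⟨n, by simpa using hn, hmul⟩
    have h3 : ClassGroup.mk0 I = (ClassGroup.mk0 I)⁻¹ :=
      eq_inv_of_mul_eq_one_left ((pow_two _).symm.trans hc)
    exact inv_injective (h3.symm.trans h2)
  obtain ⟨x, y, hx, hy, hxy⟩ := ClassGroup.mk0_eq_mk0_iff.1 h1
  simp only at hxy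
  have hnorm : x * star x = y * star y := by
    have h2 := congrArg (Ideal.map (starRingEnd _)) hxy
    rw [Ideal.map_mul, Ideal.map_mul, map_star_map_star, map_star_span_singleton,
      map_star_span_singleton] at h2
    have h3 : Ideal.span {x * star x} * I.1 = Ideal.span {y * star y} * I.1 := by
      rw [mul_comm x, ← Ideal.span_singleton_mul_span_singleton, mul_assoc, hxy, mul_left_comm, h2,
        ← Ideal.span_singleton_mul_span_singleton, mul_assoc]
    have h4 := mul_right_cancel₀ hI0 h3
    rw [Ideal.span_singleton_eq_span_singleton, ← norm_eq_mul_conj, ← norm_eq_mul_conj] at h4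
    rw [← norm_eq_mul_conj, ← norm_eq_mul_conj, Int.dvd_antisymm (norm_nonneg hd0.le x)
      (norm_nonneg hd0.le y) ((intCast_dvd_intCast _ _).1 h4.dvd)
      ((intCast_dvd_intCast _ _).1 h4.symm.dvd)]
  obtain ⟨z, hz, hzI⟩ := exists_span_mul_eq_span_star_mul hy hxy hnorm
  have hM : Ideal.span {z} * I.1 ∈ (Ideal (ℤ√d))⁰ :=
    mem_nonZeroDivisors_iff_ne_zero.2 (mul_ne_zero (by simpa using hz) hI0)
  have h2 : ClassGroup.mk0 I = ClassGroup.mk0 ⟨_, hM⟩ := by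
    rw [ClassGroup.mk0_eq_mk0_iff]
    exact ⟨z, 1, hz, one_ne_zero, by simp⟩
  rw [h2]
  apply mk0_eq_one_or_of_map_star_eq hq hq2 hd
  rw [Ideal.map_mul, map_star_span_singleton]
  exact hzI.symm

end Zsqrtd

/-! ### Arithmetic inputs: a 2-adic condition, `q` as a value of `u² - 2v²`, an auxiliary prime. -/

/-- Descent: if `A` is even, so are `X` and `Y`, and 4 cancels. If `A` is odd, then `X` is odd and
`n ≡ 1 + 14Y² mod 8`. -/
theorem emod_eight_of_mul_sq_eq {n m A X Y : ℤ} (hn : n % 2 = 1) (hm : m % 8 = 7) (hA : A ≠ 0)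
    (h : n * A ^ 2 = X ^ 2 + 2 * m * Y ^ 2) : n % 8 = 1 ∨ n % 8 = 7 := by
  induction hk : A.natAbs using Nat.strong_induction_on generalizing A X Y with
  | _ k ih =>
  subst hk
  have hsq : ∀ z : ℤ, z % 2 = 1 → z ^ 2 % 8 = 1 := fun z hz => by
    have : z % 8 = 1 ∨ z % 8 = 3 ∨ z % 8 = 5 ∨ z % 8 = 7 := by omega
    rcases this with h | h | h | h <;> simp [pow_two, Int.mul_emod, h]
  obtain ⟨m', rfl⟩ : ∃ m', m = 8 * m' + 7 := ⟨m / 8, by omega⟩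
  rcases Int.emod_two_eq_zero_or_one A with hA2 | hA2
  · obtain ⟨A', rfl⟩ := Int.dvd_of_emod_eq_zero hA2
    have hX : (2 : ℤ) ∣ X := by
      apply Int.prime_two.dvd_of_dvd_pow (n := 2)
      exact ⟨2 * (n * A' ^ 2) - (8 * m' + 7) * Y ^ 2, by linarith⟩
    obtain ⟨X', rfl⟩ := hX
    have hY : (2 : ℤ) ∣ Y := by
      apply Int.prime_two.dvd_of_dvd_pow (n := 2)
      exact ⟨n * A' ^ 2 - X' ^ 2 - (4 * m' + 3) * Y ^ 2, by linarith⟩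
    obtain ⟨Y', rfl⟩ := hY
    exact ih A'.natAbs (by omega) (by omega) (by linarith : n * A' ^ 2 = X' ^ 2 + _ * Y' ^ 2) rfl
  · obtain ⟨a, ha⟩ : ∃ a, A ^ 2 = 8 * a + 1 := ⟨A ^ 2 / 8, by have := hsq A hA2; omega⟩
    rw [ha] at h
    have hX : X % 2 = 1 := by
      by_contra hX
      obtain ⟨X', rfl⟩ : (2 : ℤ) ∣ X := by omega
      have : n = 2 * (2 * X' ^ 2 + (8 * m' + 7) * Y ^ 2 - 4 * (n * a)) := by linarith
      omega
    obtain ⟨x, hx⟩ : ∃ a, X ^ 2 = 8 * a + 1 := ⟨X ^ 2 / 8, by have := hsq X hX; omega⟩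
    rw [hx] at h
    rcases Int.emod_two_eq_zero_or_one Y with hY2 | hY2
    · obtain ⟨Y', rfl⟩ := Int.dvd_of_emod_eq_zero hY2
      have : n = 8 * (x + (8 * m' + 7) * Y' ^ 2 - n * a) + 1 := by linarith
      omega
    · obtain ⟨y, hy⟩ : ∃ a, Y ^ 2 = 8 * a + 1 := ⟨Y ^ 2 / 8, by have := hsq Y hY2; omega⟩
      rw [hy] at h
      have : n = 8 * (x + 2 * (8 * m' + 7) * y + 2 * m' + 1 - n * a) + 7 := by linarith
      omega

/-- Thue's argument: with `r² = 2` modulo `q`, the pigeonhole principle gives small `X ≡ rY`, and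
`X² - 2Y²` can only be `-q`. -/
theorem exists_eq_sq_sub_two_mul_sq {q : ℕ} (hq : q.Prime) (hq8 : q % 8 = 7) :
    ∃ u v : ℤ, (q : ℤ) = u ^ 2 - 2 * v ^ 2 := by
  have := Fact.mk hq
  obtain ⟨r, hr⟩ := (ZMod.exists_sq_eq_two_iff (p := q) (by rintro rfl; omega)).2 (Or.inr hq8)
  let k := Nat.sqrt q
  have hkq : k * k < q := lt_of_le_of_ne (Nat.sqrt_le q) fun h =>
    hq.prime.irreducible.not_isSquare ⟨k, h.symm⟩
  have hqk : q < (k + 1) * (k + 1) := Nat.lt_succ_sqrt q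
  let f : Fin (k + 1) × Fin (k + 1) → ZMod q := fun p => (p.1 : ℕ) - r * (p.2 : ℕ)
  obtain ⟨⟨x, y⟩, ⟨x', y'⟩, hne, hf⟩ := Fintype.exists_ne_map_eq_of_card_lt f (by
    simpa [ZMod.card] using hqk)
  have hmod : (((x : ℤ) - x' : ℤ) : ZMod q) = r * (((y : ℤ) - y' : ℤ) : ZMod q) := by
    simp only [f] at hf
    push_cast
    linear_combination hf
  set X : ℤ := (x : ℤ) - x' with hX
  set Y : ℤ := (y : ℤ) - y' with hY
  have hXk : X ^ 2 < q := by
    have : |X| ≤ k := by rw [abs_le]; omega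
    have h2 := mul_self_le_mul_self (abs_nonneg X) this
    rw [abs_mul_abs_self] at h2
    have : (k : ℤ) * k < q := by exact_mod_cast hkq
    linarith
  have hYk : Y ^ 2 < q := by
    have : |Y| ≤ k := by rw [abs_le]; omega
    have h2 := mul_self_le_mul_self (abs_nonneg Y) this
    rw [abs_mul_abs_self] at h2
    have : (k : ℤ) * k < q := by exact_mod_cast hkq
    linarith
  obtain ⟨m, hm⟩ : (q : ℤ) ∣ X ^ 2 - 2 * Y ^ 2 := by
    rw [← ZMod.intCast_zmod_eq_zero_iff_dvd]
    push_cast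
    rw [hmod, hr]
    ring
  have hqpos : (0 : ℤ) < q := by exact_mod_cast hq.pos
  have hm1 : m < 1 := by
    have : (q : ℤ) * m < q * 1 := by nlinarith [sq_nonneg Y]
    exact lt_of_mul_lt_mul_left this hqpos.le
  have hm2 : -2 < m := by
    have : (q : ℤ) * (-2) < q * m := by nlinarith [sq_nonneg X]
    exact lt_of_mul_lt_mul_left this hqpos.le
  have hm0 : m ≠ 0 := by
    rintro rfl
    have nsq : Zsqrtd.Nonsquare 2 := ⟨fun n h => Nat.prime_two.prime.irreducible.not_isSquare ⟨n, h⟩⟩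
    obtain ⟨h1, h2⟩ := Zsqrtd.divides_sq_eq_zero_z (d := 2) (x := X) (y := Y) (by
      push_cast; linarith)
    apply hne
    ext <;> simp <;> omega
  obtain rfl : m = -1 := by omega
  -- Multiplication by `1 + √2`, of norm `-1`, changes the sign.
  exact ⟨X + 2 * Y, X + Y, by linarith⟩

/-- Dirichlet gives a prime `p ≡ 5 mod 8` with `p ≡ -1 mod q`. Then 2 is a nonresidue mod `p`, and
by reciprocity so is `q`, so `-2q` is a residue. -/
theorem exists_prime_dvd_sq_add {q : ℕ} (hq : q.Prime) (hq8 : q % 8 = 7) :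
    ∃ p : ℕ, p % 8 = 5 ∧ ∃ b : ℤ, (p : ℤ) ∣ b ^ 2 + 2 * q := by
  have := Fact.mk hq
  have hcop : Nat.Coprime 8 q := by
    rw [Nat.coprime_comm, Nat.Prime.coprime_iff_not_dvd hq]
    intro h
    have := Nat.le_of_dvd (by norm_num) h
    interval_cases q <;> omega
  obtain ⟨k, hk8, hkq⟩ := Nat.chineseRemainder hcop 5 (q - 1)
  have hk : Nat.Coprime k (8 * q) := by
    apply Nat.Coprime.mul_right
    · rw [Nat.Coprime, hk8.gcd_eq]; norm_num
    · rw [Nat.Coprime, hkq.gcd_eq, ← Nat.Coprime]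
      exact (Nat.coprime_self_sub_left hq.one_le).2 (by simp)
  obtain ⟨p, -, hp, hpk⟩ := Nat.forall_exists_prime_gt_and_modEq 0 (by have := hq.pos; omega) hk
  have := Fact.mk hp
  have hp8 : p % 8 = 5 := (hpk.of_mul_right q).trans hk8
  have hpq : (p : ZMod q) = -1 := by
    rw [(ZMod.natCast_eq_natCast_iff _ _ _).2 ((hpk.of_mul_left 8).trans hkq),
      Nat.cast_sub hq.one_le]
    simp
  have hp2 : p ≠ 2 := by rintro rfl; omega
  have hq2 : q ≠ 2 := by rintro rfl; omega
  have h1 : IsSquare (-1 : ZMod p) := ZMod.exists_sq_eq_neg_one_iff.2 (by omega)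
  have h2 : ¬ IsSquare (2 : ZMod p) := by rw [ZMod.exists_sq_eq_two_iff hp2]; omega
  have h3 : ¬ IsSquare (q : ZMod p) := by
    rw [ZMod.exists_sq_eq_prime_iff_of_mod_four_eq_one (by omega) hq2, hpq,
      ZMod.exists_sq_eq_neg_one_iff]
    omega
  have h23 : IsSquare (2 * q : ZMod p) := by
    have e2 : legendreSym p (2 : ℤ) = -1 := (legendreSym.eq_neg_one_iff p).2 (by simpa using h2)
    have e3 : legendreSym p (q : ℤ) = -1 := (legendreSym.eq_neg_one_iff p).2 (by simpa using h3)
    have e : legendreSym p (2 * q : ℤ) = 1 := by rw [legendreSym.mul, e2, e3]; norm_num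
    have hne : ((2 * q : ℤ) : ZMod p) ≠ 0 := fun h => by
      rw [(legendreSym.eq_zero_iff p _).2 h] at e; norm_num at e
    simpa using (legendreSym.eq_one_iff p hne).1 e
  obtain ⟨s, hs⟩ := h1.mul h23
  obtain ⟨b, rfl⟩ := ZMod.intCast_surjective s
  refine ⟨p, hp8, b, ?_⟩
  rw [← ZMod.intCast_zmod_eq_zero_iff_dvd]
  push_cast
  rw [pow_two, ← hs]
  ring

/-! ### Finite abelian groups with at most one element of order 2. -/

section SquaringIndex

variable {G : Type*} [CommGroup G] [Finite G] {t : G}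

theorem card_eq_or_of_sq_eq_one (ht : ∀ g : G, g ^ 2 = 1 → g = 1 ∨ g = t) :
    Nat.card G = Nat.card (powMonoidHom 2 : G →* G).range ∨
      Nat.card G = 2 * Nat.card (powMonoidHom 2 : G →* G).range := by
  have h1 : Nat.card (powMonoidHom 2 : G →* G).ker ≤ 2 := by
    have : ((powMonoidHom 2 : G →* G).ker : Set G) ⊆ {1, t} := fun g hg => ht g hg
    calc _ = Set.ncard ((powMonoidHom 2 : G →* G).ker : Set G) := rfl
      _ ≤ Set.ncard {1, t} := Set.ncard_le_ncard this
      _ ≤ 2 := by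
        have := Set.ncard_insert_le 1 {t}
        rwa [Set.ncard_singleton] at this
  have h2 : 0 < Nat.card (powMonoidHom 2 : G →* G).ker := Nat.card_pos
  have h3 := (powMonoidHom 2 : G →* G).ker.card_mul_index
  rw [Subgroup.index_ker] at h3
  interval_cases Nat.card (powMonoidHom 2 : G →* G).ker <;> omega

theorem isSquare_mul_of_not_isSquare (ht : ∀ g : G, g ^ 2 = 1 → g = 1 ∨ g = t) {a b : G}
    (ha : ¬ IsSquare a) (hb : ¬ IsSquare b) : IsSquare (a * b) := by
  have hmem : ∀ g : G, g ∈ (powMonoidHom 2 : G →* G).range ↔ IsSquare g := fun g => by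
    simp [isSquare_iff_exists_sq, eq_comm]
  rw [← hmem] at ha hb ⊢
  have h1 := (powMonoidHom 2 : G →* G).range.card_mul_index
  have h0 : 0 < Nat.card (powMonoidHom 2 : G →* G).range := Nat.card_pos
  rcases card_eq_or_of_sq_eq_one ht with h | h
  · rw [h] at h1
    have := Subgroup.index_eq_one.1 (Nat.eq_of_mul_eq_mul_left h0 (h1.trans (mul_one _).symm))
    rw [this] at ha
    exact absurd (Subgroup.mem_top a) ha
  · rw [h, mul_comm 2] at h1
    rw [Subgroup.mul_mem_iff_of_index_two (Nat.eq_of_mul_eq_mul_left h0 h1)]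
    tauto

/-- If `8 ∣ |G|`, the fourth powers have even order and so contain the only possible involution: `t
= y⁴`. Then `x` differs from `y²` by 1 or `t`, so `x` is `y²` or `y⁶`. -/
theorem not_eight_dvd_card (ht : ∀ g : G, g ^ 2 = 1 → g = 1 ∨ g = t) {x : G} (hx : x ^ 2 = t)
    (hxs : ¬ IsSquare x) : ¬ 8 ∣ Nat.card G := by
  intro h8
  have h4 : 4 ∣ Nat.card (powMonoidHom 2 : G →* G).range := by
    rcases card_eq_or_of_sq_eq_one ht with h | h <;> omega
  have ht2 : ∃ s : (powMonoidHom 2 : G →* G).range,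
      ∀ g : (powMonoidHom 2 : G →* G).range, g ^ 2 = 1 → g = 1 ∨ g = s := by
    refine ⟨⟨t, x, hx⟩, fun g hg => ?_⟩
    have := ht g.1 (congrArg Subtype.val hg)
    exact this.imp (fun h => Subtype.ext h) fun h => Subtype.ext h
  obtain ⟨s, hs⟩ := ht2
  have h2 : 2 ∣ Nat.card
      (powMonoidHom 2 : (powMonoidHom 2 : G →* G).range →* (powMonoidHom 2 : G →* G).range).range := by
    rcases card_eq_or_of_sq_eq_one hs with h | h <;> omega
  have := Fact.mk Nat.prime_two
  obtain ⟨g, hg⟩ := exists_prime_orderOf_dvd_card' 2 h2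
  obtain ⟨⟨z, y, hy⟩, hz⟩ := g.2
  obtain ⟨w, hw⟩ : ∃ w : G, w = g.1.1 := ⟨_, rfl⟩
  have hz' : z ^ 2 = w := (congrArg Subtype.val hz).trans hw.symm
  have hy' : y ^ 2 = z := hy
  have hwt : w = t := by
    refine (ht w ?_).resolve_left fun h => ?_
    · have := pow_orderOf_eq_one g
      rw [hg] at this
      rw [hw]
      exact congrArg (fun g => g.1.1) this
    · rw [orderOf_eq_one_iff.2 (Subtype.ext (Subtype.ext (hw.symm.trans h)))] at hg
      norm_num at hg
  rcases ht (x * z⁻¹) (by rw [mul_pow, inv_pow, hx, hz', hwt, mul_inv_cancel]) with h | h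
  · exact hxs ⟨y, by rw [mul_inv_eq_one.1 h, ← hy', pow_two]⟩
  · refine hxs ⟨y ^ 3, ?_⟩
    rw [mul_inv_eq_iff_eq_mul.1 h, ← hwt, ← hz', ← hy']
    group

end SquaringIndex

/-! ### The class of order 4, the genus obstruction and the class number. -/

namespace Zsqrtd

open scoped nonZeroDivisors

theorem span_pair_ne_bot (d a b : ℤ) : Ideal.span {(a : ℤ√d), ⟨b, 1⟩} ≠ (⊥ : Ideal (ℤ√d)) := by
  intro h
  have : (⟨b, 1⟩ : ℤ√d) ∈ (⊥ : Ideal (ℤ√d)) := h ▸ Ideal.subset_span (by simp)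
  simpa using congrArg Zsqrtd.im this

/-- The ideal generated by `a` and `b + √d`, as a nonzero ideal. -/
def pairIdeal (d a b : ℤ) [IsDedekindDomain (ℤ√d)] : (Ideal (ℤ√d))⁰ :=
  ⟨Ideal.span {(a : ℤ√d), ⟨b, 1⟩}, by
    rw [mem_nonZeroDivisors_iff_ne_zero]
    exact span_pair_ne_bot d a b⟩

theorem classAboveTwo_sq {d : ℤ} (hd : Squarefree d) (hd4 : d % 4 = 2)
    [IsDedekindDomain (ℤ√d)] : classAboveTwo d ^ 2 = 1 := by
  rw [pow_two, ← eq_inv_iff_mul_eq_one, classAboveTwo, ClassGroup.mk0_eq_mk0_inv_iff]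
  refine ⟨2, two_ne_zero, ?_⟩
  have h := span_mul_span_conj hd hd4 (a := 2) (b := 0) (by omega)
  have h1 : (⟨0, 1⟩ : ℤ√d) = sqrtd := rfl
  have h2 : (⟨0, -1⟩ : ℤ√d) = -sqrtd := by ext <;> simp
  rw [h1, h2, Ideal.span_pair_neg] at h
  simpa using h

/-- A generator would have norm 2, which `X² - dY²` does not represent when `-d > 2`. -/
theorem classAboveTwo_ne_one {d : ℤ} (hd : Squarefree d) (hd4 : d % 4 = 2) (hd2 : d < -2)
    [IsDedekindDomain (ℤ√d)] : classAboveTwo d ≠ 1 := by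
  intro h
  rw [classAboveTwo, ClassGroup.mk0_eq_one_iff] at h
  obtain ⟨z, hz⟩ := h
  have hz : Ideal.span {(2 : ℤ√d), sqrtd} = Ideal.span {z} := hz
  have h := span_mul_span_conj hd hd4 (a := 2) (b := 0) (by omega)
  rw [← map_star_span_pair] at h
  have h1 : (⟨0, 1⟩ : ℤ√d) = sqrtd := rfl
  rw [h1, Int.cast_ofNat, hz, map_star_span_singleton, Ideal.span_singleton_mul_span_singleton,
    ← norm_eq_mul_conj, Ideal.span_singleton_eq_span_singleton] at h
  have h2 : ((2 : ℤ) : ℤ√d) = 2 := by simp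
  rw [← h2] at h
  have h3 := Int.dvd_antisymm (norm_nonneg (by omega) z) (by norm_num)
    ((intCast_dvd_intCast _ _).1 h.dvd) ((intCast_dvd_intCast _ _).1 h.symm.dvd)
  rw [norm_def] at h3
  have him : z.im = 0 := by
    by_contra hne
    have : 0 < z.im * z.im := mul_self_pos.2 hne
    nlinarith [mul_self_nonneg z.re]
  rw [him] at h3
  exact Int.prime_two.irreducible.not_isSquare ⟨z.re, by linarith⟩

/-- Norms in `(x)M = (y)J²` give `N(x) n = ± N(y) m²`; multiply by `N(x)` and take `A = N(x)`. -/
theorem exists_of_mk0_eq_sq {d : ℤ} (hd0 : d < 0) (hd : Squarefree d) (hd4 : d % 4 = 2)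
    [IsDedekindDomain (ℤ√d)] {M : (Ideal (ℤ√d))⁰} {n : ℤ}
    (hM : M.1 * M.1.map (starRingEnd _) = Ideal.span {(n : ℤ√d)})
    (hsq : IsSquare (ClassGroup.mk0 M)) :
    ∃ A X Y : ℤ, A ≠ 0 ∧ (n * A ^ 2 = X ^ 2 - d * Y ^ 2 ∨ -n * A ^ 2 = X ^ 2 - d * Y ^ 2) := by
  obtain ⟨c, hc⟩ := hsq
  obtain ⟨J, rfl⟩ := ClassGroup.mk0_surjective c
  obtain ⟨m, hm, hJ⟩ := exists_mul_map_star_eq hd0 hd hd4 (nonZeroDivisors.coe_ne_zero J)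
  rw [← map_mul, ClassGroup.mk0_eq_mk0_iff] at hc
  obtain ⟨x, y, hx, hy, hxy⟩ := hc
  rw [Submonoid.coe_mul] at hxy
  have h2 := congrArg (Ideal.map (starRingEnd _)) hxy
  simp only [Ideal.map_mul, map_star_span_singleton] at h2
  have h3 : Ideal.span {((x.norm * n : ℤ) : ℤ√d)} = Ideal.span {((y.norm * m ^ 2 : ℤ) : ℤ√d)} := by
    push_cast
    rw [norm_eq_mul_conj, norm_eq_mul_conj, pow_two]
    simp only [← Ideal.span_singleton_mul_span_singleton, ← hM, ← hJ]
    have h4 := congrArg₂ (· * ·) hxy h2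
    calc _ = _ := by ring
      _ = _ := h4
      _ = _ := by ring
  rw [Ideal.span_singleton_eq_span_singleton] at h3
  have h5 := Int.natAbs_eq_natAbs_iff.1 (Int.natAbs_eq_of_dvd_dvd
    ((intCast_dvd_intCast _ _).1 h3.dvd) ((intCast_dvd_intCast _ _).1 h3.symm.dvd))
  have hxn : x.norm ≠ 0 := fun h => hx ((norm_eq_zero_iff hd0 x).1 h)
  have h6 := norm_mul x y
  rw [norm_def (x * y)] at h6
  refine ⟨x.norm, (x * y).re * m, (x * y).im * m, hxn, ?_⟩
  rcases h5 with h5 | h5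
  · left
    linear_combination x.norm * h5 - m ^ 2 * h6
  · right
    linear_combination -x.norm * h5 - m ^ 2 * h6

/-- `(u, β)² (2, √d) = (β)` for `β = 2v + √d`, an element of norm `2u²`. -/
theorem sq_mk0_mul_classAboveTwo {d : ℤ} [IsDedekindDomain (ℤ√d)] {u v : ℤ}
    (hd : d = -(2 * (u ^ 2 - 2 * v ^ 2))) (hc : IsCoprime (8 * v) u) :
    ClassGroup.mk0 (pairIdeal d u (2 * v)) ^ 2 * classAboveTwo d = 1 := by
  rw [pow_two, ← eq_inv_iff_mul_eq_one, classAboveTwo]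
  have hβ0 : (⟨2 * v, 1⟩ : ℤ√d) ≠ 0 := fun h => by simpa using congrArg Zsqrtd.im h
  refine (map_mul ClassGroup.mk0 _ _).symm.trans (ClassGroup.mk0_eq_mk0_inv_iff.2
    ⟨⟨2 * v, 1⟩, hβ0, ?_⟩)
  rw [Submonoid.coe_mul, pairIdeal]
  have hb1 : (u : ℤ√d) * u * 2 = (⟨2 * v, 1⟩ : ℤ√d) * ⟨2 * v, -1⟩ := by
    ext <;> simp [hd]; ring
  have hb2 : (u : ℤ√d) * u * (sqrtd : ℤ√d) = (⟨2 * v, 1⟩ : ℤ√d) * (⟨u ^ 2 - 2 * v ^ 2, v⟩ : ℤ√d) := by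
    ext <;> simp [hd] <;> ring
  have hu : ∀ w : ℤ√d, (u : ℤ√d) ∈ Ideal.span {(u : ℤ√d), w} := fun n =>
    Ideal.subset_span (Set.mem_insert _ _)
  have hβ : (⟨2 * v, 1⟩ : ℤ√d) ∈ Ideal.span {(u : ℤ√d), ⟨2 * v, 1⟩} :=
    Ideal.subset_span (Set.mem_insert_of_mem _ rfl)
  have h2 : (2 : ℤ√d) ∈ Ideal.span {(2 : ℤ√d), sqrtd} := Ideal.subset_span (Set.mem_insert _ _)
  have hs : (sqrtd : ℤ√d) ∈ Ideal.span {(2 : ℤ√d), sqrtd} :=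
    Ideal.subset_span (Set.mem_insert_of_mem _ rfl)
  apply _root_.le_antisymm
  · simp only [Ideal.span_mul_span']
    rw [Ideal.span_le]
    rintro w hw
    obtain ⟨xy, hxy, z, hz, rfl⟩ := Set.mem_mul.1 hw
    obtain ⟨x, hx, y, hy, rfl⟩ := Set.mem_mul.1 hxy
    simp only [Set.mem_insert_iff, Set.mem_singleton_iff] at hx hy hz
    rw [SetLike.mem_coe, Ideal.mem_span_singleton]
    rcases hx with rfl | rfl
    · rcases hy with rfl | rfl
      · rcases hz with rfl | rfl
        · rw [hb1]; exact dvd_mul_right _ _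
        · rw [hb2]; exact dvd_mul_right _ _
      · exact (dvd_mul_left _ _).mul_right _
    · exact (dvd_mul_right _ _).mul_right _
  · rw [Ideal.span_singleton_le_iff_mem]
    obtain ⟨r, s, hrs⟩ := hc
    have e1 := Ideal.mul_mem_mul (Ideal.mul_mem_mul (hu ⟨2 * v, 1⟩) (hu ⟨2 * v, 1⟩)) h2
    have e2 := Ideal.mul_mem_mul (Ideal.mul_mem_mul (hu ⟨2 * v, 1⟩) (hu ⟨2 * v, 1⟩)) hs
    have e3 := Ideal.mul_mem_mul (Ideal.mul_mem_mul (hu ⟨2 * v, 1⟩) hβ) h2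
    have e4 := Ideal.mul_mem_mul (Ideal.mul_mem_mul hβ hβ) h2
    -- The product contains `8vβ`, `2uβ` and `u²β`. The coefficients come from squaring the relation
    -- `r · 8v + s · u = 1`.
    have hmem := Ideal.add_mem _ (Ideal.add_mem _
      (Ideal.mul_mem_left _ ((8 * r ^ 2 * v : ℤ) : ℤ√d)
        (Ideal.add_mem _ e4 (Ideal.mul_mem_left _ (2 : ℤ√d) e1)))
      (Ideal.mul_mem_left _ ((8 * r * s * v : ℤ) : ℤ√d) e3))
      (Ideal.mul_mem_left _ ((s ^ 2 : ℤ) : ℤ√d)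
        (Ideal.add_mem _ (Ideal.mul_mem_left _ (v : ℤ√d) e1) e2))
    rw [hb1, hb2] at hmem
    convert hmem using 1
    have hq : (8 * r ^ 2 * v) * (8 * v) + (8 * r * s * v) * (2 * u) + s ^ 2 * u ^ 2 = 1 := by
      linear_combination (r * (8 * v) + s * u + 1) * hrs
    calc (⟨2 * v, 1⟩ : ℤ√d) = ⟨2 * v, 1⟩ * (((8 * r ^ 2 * v) * (8 * v) + (8 * r * s * v) * (2 * u)
          + s ^ 2 * u ^ 2 : ℤ) : ℤ√d) := by rw [hq]; simp
      _ = ⟨2 * v, 1⟩ * (((8 * r ^ 2 * v : ℤ) : ℤ√d) * (2 * ⟨2 * v, 1⟩ + 2 * ⟨2 * v, -1⟩) +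
          ((8 * r * s * v : ℤ) : ℤ√d) * (2 * u) + ((s ^ 2 : ℤ) : ℤ√d) *
          ((v : ℤ√d) * (⟨2 * v, -1⟩ : ℤ√d) + (⟨u ^ 2 - 2 * v ^ 2, v⟩ : ℤ√d))) := by
        congr 1
        have f1 : (2 * ⟨2 * v, 1⟩ + 2 * ⟨2 * v, -1⟩ : ℤ√d) = ((8 * v : ℤ) : ℤ√d) := by
          ext <;> simp; ring
        have f2 : ((v : ℤ√d) * ⟨2 * v, -1⟩ + ⟨u ^ 2 - 2 * v ^ 2, v⟩ : ℤ√d) =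
            ((u ^ 2 : ℤ) : ℤ√d) := by
          rw [pow_two, pow_two]
          ext <;> simp; ring
        rw [f1, f2]
        push_cast
        ring
      _ = _ := by ring

theorem pairIdeal_mul_map_star {d : ℤ} (hd : Squarefree d) (hd4 : d % 4 = 2)
    [IsDedekindDomain (ℤ√d)] {a b : ℤ} (h : a ∣ b ^ 2 - d) :
    (pairIdeal d a b).1 * (pairIdeal d a b).1.map (starRingEnd _) = Ideal.span {(a : ℤ√d)} := by
  rw [pairIdeal, map_star_span_pair, span_mul_span_conj hd hd4 h]

theorem emod_eight_of_isSquare_mk0 {q : ℕ} (hq : q.Prime) (hq8 : q % 8 = 7) {d : ℤ}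
    (hd : d = -(2 * q)) [IsDedekindDomain (ℤ√d)] {M : (Ideal (ℤ√d))⁰} {n : ℤ} (hn : n % 2 = 1)
    (hM : M.1 * M.1.map (starRingEnd _) = Ideal.span {(n : ℤ√d)})
    (hsq : IsSquare (ClassGroup.mk0 M)) : n % 8 = 1 ∨ n % 8 = 7 := by
  have hq2 : q ≠ 2 := by rintro rfl; omega
  obtain ⟨A, X, Y, hA, h⟩ := exists_of_mk0_eq_sq (by have := hq.pos; omega)
    (hd ▸ squarefree_neg_two_mul hq hq2) (hd ▸ neg_two_mul_emod_four hq hq2) hM hsq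
  have hq8' : (q : ℤ) % 8 = 7 := by omega
  rcases h with h | h
  · exact emod_eight_of_mul_sq_eq (X := X) (Y := Y) hn hq8' hA (by rw [h, hd]; ring)
  · have := emod_eight_of_mul_sq_eq (n := -n) (X := X) (Y := Y) (by omega) hq8' hA
      (by rw [h, hd]; ring)
    omega

theorem natCard_classGroup {q : ℕ} (hq : q.Prime) {d : ℤ} (hd : d = -(2 * q))
    [IsDedekindDomain (ℤ√d)] [Finite (ClassGroup (ℤ√d))] :
    (q % 16 = 7 → 4 ∣ Nat.card (ClassGroup (ℤ√d)) ∧ ¬ 8 ∣ Nat.card (ClassGroup (ℤ√d))) ∧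
      (q % 16 = 15 → 8 ∣ Nat.card (ClassGroup (ℤ√d))) := by
  by_cases hq8 : q % 8 = 7
  swap
  · exact ⟨fun h => by omega, fun h => by omega⟩
  have hq2 : q ≠ 2 := by rintro rfl; omega
  have hsf : Squarefree d := hd ▸ squarefree_neg_two_mul hq hq2
  have hd4 : d % 4 = 2 := hd ▸ neg_two_mul_emod_four hq hq2
  have ht := fun c : ClassGroup (ℤ√d) =>
    eq_one_or_eq_classAboveTwo_of_sq_eq_one hq hq2 hd (c := c)
  have ht1 : classAboveTwo d ≠ 1 := classAboveTwo_ne_one hsf hd4 (by omega)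
  have ht2 : classAboveTwo d ^ 2 = 1 := classAboveTwo_sq hsf hd4
  obtain ⟨u, v, huv⟩ := exists_eq_sq_sub_two_mul_sq hq hq8
  have hu : u % 2 = 1 := by
    by_contra h
    obtain ⟨w, rfl⟩ : (2 : ℤ) ∣ u := by omega
    have : (q : ℤ) = 2 * (2 * w ^ 2 - v ^ 2) := by rw [huv]; ring
    omega
  have hcop : IsCoprime (8 * v) u := by
    have h8 : IsCoprime (8 : ℤ) u := by
      rw [show (8 : ℤ) = 2 ^ 3 by norm_num]
      exact IsCoprime.pow_left ⟨-(u / 2), 1, by omega⟩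
    refine h8.mul_left ((isCoprime_of_prime_dvd ?_ ?_))
    · rintro ⟨rfl, rfl⟩
      omega
    · intro p hp hpv hpu
      have h1 : p * p ∣ (q : ℤ) := by
        rw [huv, pow_two, pow_two]
        exact dvd_sub (mul_dvd_mul hpu hpu) ((mul_dvd_mul hpv hpv).mul_left 2)
      exact hp.not_isUnit ((Nat.prime_iff_prime_int.1 hq).squarefree p h1)
  set x := ClassGroup.mk0 (pairIdeal d u (2 * v)) with hx
  have hx2 : x ^ 2 = classAboveTwo d := by
    have h1 : x ^ 2 * classAboveTwo d = 1 := sq_mk0_mul_classAboveTwo (by rw [hd, huv]) hcop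
    rw [pow_two] at ht2
    exact mul_right_cancel (h1.trans ht2.symm)
  have hxM := pairIdeal_mul_map_star hsf hd4 (a := u) (b := 2 * v)
    ⟨2 * u, by rw [hd, huv]; ring⟩
  -- `v` is odd, for otherwise `q ≡ 1 mod 4`; hence `2v² ≡ 2 mod 16`.
  have hx16 : u ^ 2 % 16 = (q + 2 : ℤ) % 16 := by
    have hv : v % 2 = 1 := by
      by_contra h
      obtain ⟨w, rfl⟩ : (2 : ℤ) ∣ v := by omega
      obtain ⟨z, rfl⟩ : ∃ z, u = 2 * z + 1 := ⟨u / 2, by omega⟩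
      have : (q : ℤ) = 4 * (z ^ 2 + z - 2 * w ^ 2) + 1 := by rw [huv]; ring
      omega
    obtain ⟨w, rfl⟩ : ∃ w, v = 2 * w + 1 := ⟨v / 2, by omega⟩
    obtain ⟨z, hz⟩ := Int.even_mul_succ_self w
    have : u ^ 2 = q + 2 + 16 * z := by linear_combination -huv + 8 * hz
    omega
  have h4 : orderOf x = 4 := by
    refine orderOf_eq_prime_pow (p := 2) (n := 1) ?_ ?_
    · rw [pow_one, hx2]; exact ht1
    · rw [show 2 ^ (1 + 1) = 2 * 2 by norm_num, pow_mul, hx2, ht2]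
  have hmod : u % 8 = 1 ∨ u % 8 = 3 ∨ u % 8 = 5 ∨ u % 8 = 7 := by omega
  obtain ⟨k, hk⟩ : ∃ k, u = 8 * k + u % 8 := ⟨u / 8, by omega⟩
  constructor
  · intro hq16
    refine ⟨h4 ▸ orderOf_dvd_natCard x, not_eight_dvd_card ht hx2 fun hsq => ?_⟩
    have h7 := emod_eight_of_isSquare_mk0 hq hq8 hd hu hxM hsq
    have : u ^ 2 % 16 = 1 := by
      rw [hk]
      rcases h7 with h | h <;> rw [h]
      · rw [show (8 * k + 1) ^ 2 = 16 * (4 * k ^ 2 + k) + 1 by ring]; omega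
      · rw [show (8 * k + 7) ^ 2 = 16 * (4 * k ^ 2 + 7 * k + 3) + 1 by ring]; omega
    omega
  · intro hq16
    have hu8 : u % 8 = 1 ∨ u % 8 = 7 := by
      have : u ^ 2 % 16 = 1 := by omega
      rw [hk] at this
      rcases hmod with h | h | h | h
      · exact Or.inl h
      · rw [h, show (8 * k + 3) ^ 2 = 16 * (4 * k ^ 2 + 3 * k) + 9 by ring] at this; omega
      · rw [h, show (8 * k + 5) ^ 2 = 16 * (4 * k ^ 2 + 5 * k + 1) + 9 by ring] at this; omega
      · exact Or.inr h
    obtain ⟨p, hp8, b, hb⟩ := exists_prime_dvd_sq_add hq hq8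
    have hyM := pairIdeal_mul_map_star hsf hd4 (a := p) (b := b)
      (by rwa [hd, sub_neg_eq_add])
    set y := ClassGroup.mk0 (pairIdeal d p b) with hy
    have hyns : ¬ IsSquare y := fun h => by
      have := emod_eight_of_isSquare_mk0 hq hq8 hd (by omega) hyM h
      omega
    -- Squares have index at most 2, so if `x` were a nonsquare, `xy` would be a square. Its ideal
    -- has norm `±up ≡ ±3 mod 8`, which the genus obstruction forbids.
    have hxsq : IsSquare x := by
      by_contra hxns
      have hxy : IsSquare (ClassGroup.mk0 (pairIdeal d u (2 * v) * pairIdeal d p b)) := by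
        rw [map_mul]
        exact isSquare_mul_of_not_isSquare ht hxns hyns
      have h1 : (u * p) % 8 = 5 ∨ (u * p) % 8 = 3 := by
        have : (p : ℤ) % 8 = 5 := by omega
        rw [Int.mul_emod, this]
        rcases hu8 with h | h <;> rw [h] <;> norm_num
      have := emod_eight_of_isSquare_mk0 hq hq8 hd (n := u * p) (by omega) (by
        rw [Submonoid.coe_mul, Ideal.map_mul, mul_mul_mul_comm, hxM, hyM,
          Ideal.span_singleton_mul_span_singleton, Int.cast_mul]) hxy
      omega
    obtain ⟨z, hz⟩ := hxsq
    have hz8 : orderOf z = 8 := by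
      refine orderOf_eq_prime_pow (p := 2) (n := 2) ?_ ?_
      · rw [show 2 ^ 2 = 2 * 2 by norm_num, pow_mul, pow_two z, ← hz, hx2]; exact ht1
      · rw [show 2 ^ (2 + 1) = 2 * 2 * 2 by norm_num, pow_mul, pow_mul, pow_two z, ← hz, hx2, ht2]
    exact hz8 ▸ orderOf_dvd_natCard z

end Zsqrtd

/-! ### `ℤ√d` as the ring of integers, and the conclusion. -/

theorem exists_int_eq_of_sq_eq {r : ℚ} {n : ℤ} (h : r ^ 2 = n) : ∃ m : ℤ, (m : ℚ) = r := by
  have : IsIntegral ℤ r := by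
    refine IsIntegral.of_pow (n := 2) two_pos ?_
    rw [h]
    exact isIntegral_algebraMap (R := ℤ) (A := ℚ) (x := n)
  exact IsIntegrallyClosed.isIntegral_iff.1 this

theorem exists_int_of_trace_norm_int {q : ℕ} (hq : q.Prime) (hq2 : q ≠ 2) {a b : ℚ} {m n : ℤ}
    (hm : 2 * a = m) (hn : a ^ 2 + 2 * q * b ^ 2 = n) :
    (∃ k : ℤ, (k : ℚ) = a) ∧ ∃ l : ℤ, (l : ℚ) = b := by
  have hq0 : (q : ℚ) ≠ 0 := by exact_mod_cast hq.ne_zero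
  have hq0' : (q : ℤ) ≠ 0 := by exact_mod_cast hq.ne_zero
  -- `4n - m² = 8qb²`, so `(4qb)²` is the integer `2q(4n - m²)`. Divisibility by 2 and `q` then
  -- makes `2b` an integer, and parity removes the remaining 2.
  obtain ⟨s, hs⟩ := exists_int_eq_of_sq_eq (r := 4 * q * b) (n := 2 * q * (4 * n - m ^ 2)) (by
    push_cast; rw [← hm, ← hn]; ring)
  have hsz : s ^ 2 = 2 * q * (4 * n - m ^ 2) := by
    have : (s : ℚ) ^ 2 = 2 * q * (4 * n - m ^ 2) := by rw [hs, ← hm, ← hn]; ring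
    exact_mod_cast this
  have h2s : (2 : ℤ) ∣ s := Int.prime_two.dvd_of_dvd_pow (n := 2)
    ⟨q * (4 * n - m ^ 2), by rw [hsz]; ring⟩
  have hqs : (q : ℤ) ∣ s := (Nat.prime_iff_prime_int.1 hq).dvd_of_dvd_pow (n := 2)
    ⟨2 * (4 * n - m ^ 2), by rw [hsz]; ring⟩
  have hqo : (q : ℤ) % 2 = 1 := by have := hq.eq_two_or_odd; omega
  have hcop : IsCoprime (2 : ℤ) q := ⟨-(q / 2), 1, by omega⟩
  obtain ⟨t, rfl⟩ := hcop.mul_dvd h2s hqs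
  have ht : (t : ℚ) = 2 * b := by
    push_cast at hs
    have : (2 * q : ℚ) * t = 2 * q * (2 * b) := by linarith
    exact mul_left_cancel₀ (by positivity) this
  have hz : 2 * q * t ^ 2 = 4 * n - m ^ 2 := by
    have : (2 * q * (t : ℚ) ^ 2) = 4 * n - m ^ 2 := by rw [ht, ← hm, ← hn]; ring
    exact_mod_cast this
  have h2m : (2 : ℤ) ∣ m := Int.prime_two.dvd_of_dvd_pow (n := 2)
    ⟨2 * n - q * t ^ 2, by linarith⟩
  obtain ⟨k, rfl⟩ := h2m
  have h2t : (2 : ℤ) ∣ t := by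
    have h1 : (2 : ℤ) ∣ q * t ^ 2 := ⟨n - k ^ 2, by linarith⟩
    exact Int.prime_two.dvd_of_dvd_pow (hcop.dvd_of_dvd_mul_left h1)
  obtain ⟨l, rfl⟩ := h2t
  push_cast at hm ht
  exact ⟨⟨k, by linarith⟩, l, by linarith⟩

section

variable {K : Type*} [Field K] [NumberField K] {α : K} {q : ℕ}

theorem exists_rat_add_mul_eq (hα : α ^ 2 = -(2 * (q : K)))
    (hK : IntermediateField.adjoin ℚ {α} = ⊤) (x : K) : ∃ a b : ℚ, x = a + b * α := by
  have hint : IsIntegral ℚ α := Algebra.IsIntegral.isIntegral α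
  have hx : x ∈ Algebra.adjoin ℚ {α} := by
    rw [← IntermediateField.adjoin_simple_toSubalgebra_of_isAlgebraic hint.isAlgebraic, hK]
    trivial
  induction hx using Algebra.adjoin_induction with
  | mem x hx => exact ⟨0, 1, by simpa using hx⟩
  | algebraMap r => exact ⟨r, 0, by simp⟩
  | add x y _ _ hx hy =>
    obtain ⟨a, b, rfl⟩ := hx
    obtain ⟨c, e, rfl⟩ := hy
    exact ⟨a + c, b + e, by push_cast; ring⟩
  | mul x y _ _ hx hy =>
    obtain ⟨a, b, rfl⟩ := hx
    obtain ⟨c, e, rfl⟩ := hy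
    exact ⟨a * c - 2 * q * b * e, a * e + b * c, by
      push_cast; linear_combination (b * e : K) * hα⟩

theorem ne_rat_of_sq_eq (hq : q.Prime) (hα : α ^ 2 = -(2 * (q : K))) (r : ℚ) : α ≠ r := by
  rintro rfl
  have : r ^ 2 = -(2 * q) := by exact_mod_cast hα
  have hq0 : (0 : ℚ) < q := by exact_mod_cast hq.pos
  nlinarith [sq_nonneg r]

open Polynomial in
-- For `b ≠ 0` the minimal polynomial is the quadratic with the trace and norm as coefficients, and
-- integrality makes these integers.
theorem exists_int_of_isIntegral (hq : q.Prime) (hq2 : q ≠ 2) (hα : α ^ 2 = -(2 * (q : K)))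
    {a b : ℚ} (h : IsIntegral ℤ ((a : K) + b * α)) :
    (∃ k : ℤ, (k : ℚ) = a) ∧ ∃ l : ℤ, (l : ℚ) = b := by
  by_cases hb : b = 0
  · subst hb
    refine ⟨?_, 0, by simp⟩
    have h1 : IsIntegral ℤ (algebraMap ℚ K a) := by simpa using h
    exact IsIntegrallyClosed.isIntegral_iff.1
      ((isIntegral_algebraMap_iff (algebraMap ℚ K).injective).1 h1)
  set x : K := (a : K) + b * α with hx
  have hmin := minpoly.isIntegrallyClosed_eq_field_fractions' ℚ h
  have hP : minpoly ℚ x = X ^ 2 + C (-(2 * a)) * X + C (a ^ 2 + 2 * q * b ^ 2) := by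
    have hmonic : (X ^ 2 + C (-(2 * a)) * X + C (a ^ 2 + 2 * q * b ^ 2) : ℚ[X]).Monic := by
      monicity!
    have hdeg : (X ^ 2 + C (-(2 * a)) * X + C (a ^ 2 + 2 * q * b ^ 2) : ℚ[X]).natDegree = 2 := by
      compute_degree!
    symm
    refine Polynomial.eq_of_monic_of_dvd_of_natDegree_le (minpoly.monic h.tower_top) hmonic
      (minpoly.dvd ℚ x ?_) ?_
    · simp only [map_add, map_mul, map_pow, aeval_X, aeval_C, eq_ratCast]
      push_cast
      rw [hx]
      linear_combination (b : K) ^ 2 * hα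
    · rw [hdeg, minpoly.two_le_natDegree_iff h.tower_top]
      rintro ⟨r, hr⟩
      rw [eq_ratCast] at hr
      refine ne_rat_of_sq_eq hq hα ((r - a) / b) ?_
      have : (b : K) ≠ 0 := by exact_mod_cast hb
      push_cast
      rw [eq_div_iff this, hr, hx]
      ring
  obtain ⟨s, hs⟩ : ∃ s, s = -(2 * a) := ⟨_, rfl⟩
  obtain ⟨p, hp⟩ : ∃ p, p = a ^ 2 + 2 * q * b ^ 2 := ⟨_, rfl⟩
  rw [hP, ← hs, ← hp] at hmin
  have h0 := congrArg (fun p => p.coeff 0) hmin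
  have h1 := congrArg (fun p => p.coeff 1) hmin
  simp [coeff_X, coeff_C] at h0 h1
  exact exists_int_of_trace_norm_int hq hq2 (m := -(minpoly ℤ x).coeff 1)
    (n := (minpoly ℤ x).coeff 0) (by push_cast; linarith) (hp ▸ h0)

theorem isIntegralClosure_zsqrtd (hq : q.Prime) (hq2 : q ≠ 2) (hα : α ^ 2 = -(2 * (q : K)))
    (hK : IntermediateField.adjoin ℚ {α} = ⊤) {d : ℤ} [Algebra (ℤ√d) K]
    (hmap : ∀ z : ℤ√d, algebraMap (ℤ√d) K z = z.re + z.im * α) : IsIntegralClosure (ℤ√d) ℤ K where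
  algebraMap_injective := by
    rw [injective_iff_map_eq_zero]
    intro z hz
    rw [hmap] at hz
    have him : z.im = 0 := by
      by_contra h
      have h' : (z.im : K) ≠ 0 := by exact_mod_cast h
      refine ne_rat_of_sq_eq hq hα (-z.re / z.im) ?_
      push_cast
      rw [eq_div_iff h']
      linear_combination hz
    rw [him] at hz
    have hre : z.re = 0 := by simpa using hz
    exact Zsqrtd.ext hre him
  isIntegral_iff := by
    intro x
    constructor
    · intro hx
      obtain ⟨a, b, rfl⟩ := exists_rat_add_mul_eq hα hK x
      obtain ⟨⟨k, rfl⟩, l, rfl⟩ := exists_int_of_isIntegral hq hq2 hα hx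
      exact ⟨⟨k, l⟩, by rw [hmap]; push_cast; rfl⟩
    · rintro ⟨z, rfl⟩
      rw [hmap]
      have hαi : IsIntegral ℤ α := by
        refine IsIntegral.of_pow (n := 2) two_pos ?_
        rw [hα]
        simpa using isIntegral_algebraMap (R := ℤ) (A := K) (x := -(2 * q))
      have hi : ∀ n : ℤ, IsIntegral ℤ (n : K) := fun n =>
        isIntegral_algebraMap (R := ℤ) (A := K) (x := n)
      exact (hi _).add ((hi _).mul hαi)

end

theorem mainTheorem8 (q : ℕ) (hq : q.Prime)
    (K : Type*) [Field K] [NumberField K]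
    (α : K) (hα : α ^ 2 = -(2 * (q : K))) (hK : IntermediateField.adjoin ℚ {α} = ⊤) :
    (q ≡ 7 [MOD 16] →
      4 ∣ NumberField.classNumber K ∧ ¬ 8 ∣ NumberField.classNumber K) ∧
    (q ≡ 15 [MOD 16] → 8 ∣ NumberField.classNumber K) := by
  by_cases hq2 : q = 2
  · subst hq2
    exact ⟨fun h => absurd h (by decide), fun h => absurd h (by decide)⟩
  obtain ⟨d, hd⟩ : ∃ d : ℤ, d = -(2 * q) := ⟨_, rfl⟩
  let f : ℤ√d →+* K := Zsqrtd.lift ⟨α, by rw [← pow_two, hα, hd]; push_cast; rfl⟩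
  let _ : Algebra (ℤ√d) K := f.toAlgebra
  have hmap : ∀ z : ℤ√d, algebraMap (ℤ√d) K z = z.re + z.im * α := fun z => rfl
  have := isIntegralClosure_zsqrtd hq hq2 hα hK hmap
  have : IsDomain (ℤ√d) := (IsIntegralClosure.algebraMap_injective (ℤ√d) ℤ K).isDomain _
  have : IsDedekindDomain (ℤ√d) := IsIntegralClosure.isDedekindDomain ℤ ℚ K (ℤ√d)
  let e := ClassGroup.mulEquiv (NumberField.RingOfIntegers.equiv (K := K) (ℤ√d))
  have : Finite (ClassGroup (ℤ√d)) := Finite.of_equiv _ e.toEquiv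
  have hcard : NumberField.classNumber K = Nat.card (ClassGroup (ℤ√d)) := by
    rw [← Nat.card_congr e.toEquiv, NumberField.classNumber, Nat.card_eq_fintype_card]
  rw [hcard]
  exact Zsqrtd.natCard_classGroup hq hd
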